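/- Let $d\in\mathbb N$, $1\le p<\infty$, $\mathbb N_{-1}=\{-1,0,1,2,\dots\}$. Let $\varphi=(\varphi_n)_{n\ge 0}$ be a smooth dyadic decomposition of unity on $\mathbb R$: $\varphi_n\in C_0^\infty(\mathbb R)$, $\operatorname{supp}\varphi_0\subset\{|x|\le 2\}$, $\operatorname{supp}\varphi_n\subset\{2^{n-1}\le |x|\le 2^{n+1}\}$ for $n\ge1$, $\sup_{x,n}2^{n\ell}|D^\ell\varphi_n(x)|<\infty$ for every $\ell\in\mathbb N_0$, and $\sum_{n}\varphi_n(x)=1$ for all $x$. For $f\in L_1(\mathbb R^d)$ and $\ell\in\mathbb N_0^d$ put $f_\ell=\mathcal F^{-1}[\varphi_{\ell_1}(\xi_1)\cdots\varphi_{\ell_d}(\xi_d)\,\mathcal F f(\xi)]$, where $\mathcal Ff(\xi)=(2\pi)^{-d/2}\int_{\mathbb R^d} f(x)e^{-i\xi\cdot x}\,dx$ and $\mathcal F^{-1}$ is its inverse. The space $S^{1/p}_{p,1}B(\mathbb R^d)$ consists of all $f\in L_1(\mathbb R^d)$ with $$\|f|S^{1/p}_{p,1}B(\mathbb R^d)\|:=\sum_{\ell\in\mathbb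 N_0^d}2^{|\ell|_1/p}\|f_\ell\|_{L_p(\mathbb R^d)}<\infty .$$ For continuous $f:\mathbb R^d\to\mathbb C$, $j\in\mathbb N_{-1}^d$ and $k\in\mathbb Z^d$ define the Faber–Schauder coefficients $$d^2_{j,k}(f)=(-2)^{-|e(j)|}\,\Delta^{2,e(j)}_{2^{-(j+1)}}(f,x_{j,k}),\qquad e(j)=\{i:j_i\ne-1\},\quad x_{j,k}=(2^{-\max(j_1,0)}k_1,\dots,2^{-\max(j_d,0)}k_d),$$ where $\Delta^{2,e(j)}_{2^{-(j+1)}}$ is the composition over $i\in e(j)$ of the second forward differences $g\mapsto g(\cdot+2h_ie_i)-2g(\cdot+h_ie_i)+g$ with step $h_i=2^{-(j_i+1)}$ in the $i$-th coordinate direction. Then there is a constant $c>0$, independent of $f$ (depending only on $d$, $p$ and $\varphi$), such that every $f\in S^{1/p}_{p,1}B(\mathbb R^d)$ has a (unique) continuous representative and, with the coefficients computed from this representative, $$\|d^2_{j,k}(f)|s^{1/p}_{p,\infty}b\|=\sup_{j\in\mathbb N_{-1}^d}\Big(\sum_{k\in\mathbb Z^d}|d^2_{j,k}(f)|^p\Big)^{1/p}\le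 c\,\|f|S^{1/p}_{p,1}B(\mathbb R^d)\| .$$ -/

import Mathlib

open MeasureTheory Filter
open scoped ENNReal NNReal

namespace MixedBesov

/-- A smooth dyadic decomposition of unity on the real line: the class `Φ(ℝ)`.
Compactness of the supports is contained in the two support conditions. -/
structure IsDyadicDecomposition (φ : ℕ → ℝ → ℂ) : Prop where
  smooth : ∀ n, ContDiff ℝ ((⊤ : ℕ∞) : WithTop ℕ∞) (φ n)
  support_zero : tsupport (φ 0) ⊆ {x : ℝ | |x| ≤ 2}
  support_pos : ∀ n, 1 ≤ n →
    tsupport (φ n) ⊆ {x : ℝ | (2 : ℝ) ^ ((n : ℤ) - 1) ≤ |x| ∧ |x| ≤ (2 : ℝ) ^ ((n : ℤ) + 1)}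
  deriv_bound : ∀ l : ℕ, ∃ c : ℝ, ∀ (n : ℕ) (x : ℝ),
    (2 : ℝ) ^ (n * l) * ‖iteratedDeriv l (φ n) x‖ ≤ c
  sum_eq_one : ∀ x : ℝ, HasSum (fun n => φ n x) 1

/-- `𝓕 f(ξ) = (2π)^{-d/2} ∫ f(x) e^{-i ξ·x} dx`. The space `ℝ^d` is `Fin d → ℝ`; only its topology
and its Lebesgue measure are used. -/
noncomputable def fourier {d : ℕ} (f : (Fin d → ℝ) → ℂ) (ξ : Fin d → ℝ) : ℂ :=
  (((2 * Real.pi) ^ (-(d : ℝ) / 2) : ℝ) : ℂ) *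
    ∫ x : Fin d → ℝ, f x * Complex.exp (-(Complex.I * ((∑ i, ξ i * x i : ℝ) : ℂ)))

/-- `𝓕⁻¹ f(ξ) = (2π)^{-d/2} ∫ f(x) e^{i ξ·x} dx`. -/
noncomputable def fourierInv {d : ℕ} (f : (Fin d → ℝ) → ℂ) (ξ : Fin d → ℝ) : ℂ :=
  (((2 * Real.pi) ^ (-(d : ℝ) / 2) : ℝ) : ℂ) *
    ∫ x : Fin d → ℝ, f x * Complex.exp (Complex.I * ((∑ i, ξ i * x i : ℝ) : ℂ))

/-- The building block `f_ℓ = 𝓕⁻¹[φ_{ℓ₁}(ξ₁) ⋯ φ_{ℓ_d}(ξ_d) 𝓕 f(ξ)]`, for integrable `f`. -/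
noncomputable def block {d : ℕ} (φ : ℕ → ℝ → ℂ) (f : (Fin d → ℝ) → ℂ) (l : Fin d → ℕ) :
    (Fin d → ℝ) → ℂ :=
  fourierInv (fun ξ => (∏ i, φ (l i) (ξ i)) * fourier f ξ)

/-- The `ℓ_q` (quasi-)norm of a family of extended nonnegative numbers, `0 < q ≤ ∞`. -/
noncomputable def lqNorm {ι : Type*} (q : ℝ≥0∞) (a : ι → ℝ≥0∞) : ℝ≥0∞ :=
  if q = ∞ then ⨆ i, a i else (∑' i, a i ^ q.toReal) ^ (1 / q.toReal)

/-- The (quasi-)norm of `S^r_{p,q}B(ℝ^d)` built with the decomposition `φ`. -/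
noncomputable def besovNorm {d : ℕ} (φ : ℕ → ℝ → ℂ) (r : ℝ) (p q : ℝ≥0∞)
    (f : (Fin d → ℝ) → ℂ) : ℝ≥0∞ :=
  lqNorm q (fun j : Fin d → ℕ =>
    (2 : ℝ≥0∞) ^ ((∑ i, (j i : ℝ)) * r) * eLpNorm (block φ f j) p volume)

/-- `f ∈ S^r_{p,q}B(ℝ^d)`: `f ∈ L_1(ℝ^d)` and the (quasi-)norm is finite. -/
def MemBesov {d : ℕ} (φ : ℕ → ℝ → ℂ) (r : ℝ) (p q : ℝ≥0∞) (f : (Fin d → ℝ) → ℂ) : Prop :=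
  Integrable f volume ∧ besovNorm φ r p q f < ∞

/-- The levels `ℕ_{-1}^d`, where `ℕ_{-1} = {-1, 0, 1, 2, …}`. -/
abbrev Level (d : ℕ) : Type := Fin d → {m : ℤ // -1 ≤ m}

/-- The (quasi-)norm of the sequence space `s^r_{p,q}b`, with `|j|_1 = ∑ |j_i|`. -/
noncomputable def seqNorm {d : ℕ} (r : ℝ) (p q : ℝ≥0∞)
    (a : Level d → (Fin d → ℤ) → ℂ) : ℝ≥0∞ :=
  lqNorm q (fun j : Level d =>
    (2 : ℝ≥0∞) ^ ((∑ i, |((j i : ℤ) : ℝ)|) * (r - 1 / p.toReal)) *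
      lqNorm p (fun k : Fin d → ℤ => ‖a j k‖ₑ))

/-- The mixed second difference `Δ^{2,e}_h f`: the composition, over the directions `i ∈ e`, of the
second forward differences `g ↦ g(· + 2 h_i e_i) - 2 g(· + h_i e_i) + g`. -/
noncomputable def mixedDiff {d : ℕ} (e : Finset (Fin d)) (h : Fin d → ℝ)
    (f : (Fin d → ℝ) → ℂ) : (Fin d → ℝ) → ℂ :=
  (List.finRange d).foldr
    (fun i g => if i ∈ e then (fwdDiff (Pi.single i (h i) : Fin d → ℝ))^[2] g else g) f

/-- The set `e(j)` of the directions `i` with `j_i ≠ -1`. -/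
def activeDirs {d : ℕ} (j : Level d) : Finset (Fin d) :=
  Finset.univ.filter (fun i => (j i : ℤ) ≠ -1)

/-- The grid point `x_{j,k} = (2^{-(j_1)_+} k_1, …, 2^{-(j_d)_+} k_d)`. -/
noncomputable def gridPoint {d : ℕ} (j : Level d) (k : Fin d → ℤ) : Fin d → ℝ :=
  fun i => (2 : ℝ) ^ (-(max (j i : ℤ) 0)) * (k i : ℝ)

/-- The Faber–Schauder coefficient
`d²_{j,k}(f) = (-2)^{-|e(j)|} Δ^{2,e(j)}_{2^{-(j+1)}}(f, x_{j,k})`. -/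
noncomputable def faberCoeff {d : ℕ} (f : (Fin d → ℝ) → ℂ) (j : Level d) (k : Fin d → ℤ) : ℂ :=
  ((-2 : ℂ) ^ (activeDirs j).card)⁻¹ *
    mixedDiff (activeDirs j) (fun i => (2 : ℝ) ^ (-((j i : ℤ) + 1))) f (gridPoint j k)

end MixedBesov

namespace MixedBesov

/-! Expand f = Σ_ℓ f_ℓ. The frequencies of f_ℓ satisfy |ξ_i| ≤ 2^{ℓ_i+1}, so f_ℓ equals its
convolution with a tensor product of dilated Schwartz functions (`block_eq_integral`), and a mixed
difference can be moved onto that kernel. Sampling the differences of f_ℓ on the grid is thus an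
integral operator from L_p to ℓ_p. Schur's test (`tsum_lintegral_mul_rpow_le`) reduces its norm to
two one-dimensional bounds, collected in `exists_levelKernel_bound`: the L_1 norm of the kernel is
O(1) and its sum over the grid is O(2^{ℓ_i}), both uniformly in j. The second bound is uniform
because a second difference with step h lives on an interval of length 2h, exactly the grid spacing:
the sum over k is at most the total variation of the dilated function.

The p-th root turns the loss into 2^{|ℓ|_1/p}, which is the Besov weight
(`exists_tsum_mixedDiff_block_le`). As the Besov norm has q = 1, the triangle inequality in ℓ_p
(`tsum_tsum_rpow_le`) adds up the pieces.

At level (-1, …, -1) no difference is taken, and the same estimate bounds sup |f_ℓ|. Hence the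
series converges uniformly, and testing against smooth functions identifies its continuous sum with
f almost everywhere (`tsum_block_ae_eq`). -/

/-! ### Elementary Fourier analysis on L_1. -/

lemma fourierInv_eq_fourier_neg {d : ℕ} (f : (Fin d → ℝ) → ℂ) (ξ : Fin d → ℝ) :
    fourierInv f ξ = fourier f (-ξ) := by
  simp [fourierInv, fourier, Finset.sum_neg_distrib]

lemma norm_cexp_neg_I_mul (t : ℝ) : ‖Complex.exp (-(Complex.I * (t : ℂ)))‖ = 1 := by
  rw [Complex.norm_exp]
  simp

lemma integrable_mul_cexp {d : ℕ} {f : (Fin d → ℝ) → ℂ} (hf : Integrable f) (ξ : Fin d → ℝ) :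
    Integrable (fun x => f x * Complex.exp (-(Complex.I * ((∑ i, ξ i * x i : ℝ) : ℂ)))) := by
  refine hf.mul_bdd (c := 1) (Continuous.aestronglyMeasurable (by fun_prop)) (ae_of_all _ fun x => ?_)
  exact (norm_cexp_neg_I_mul _).le

lemma continuous_fourier {d : ℕ} {f : (Fin d → ℝ) → ℂ} (hf : Integrable f) :
    Continuous (fourier f) := by
  unfold fourier
  refine continuous_const.mul ?_
  refine continuous_of_dominated (bound := fun x => ‖f x‖) ?_ ?_ hf.norm ?_
  · exact fun ξ => (integrable_mul_cexp hf ξ).aestronglyMeasurable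
  · intro ξ
    refine ae_of_all _ fun x => ?_
    rw [norm_mul, norm_cexp_neg_I_mul, mul_one]
  · refine ae_of_all _ fun x => ?_
    fun_prop

lemma exists_norm_fourier_le {d : ℕ} (f : (Fin d → ℝ) → ℂ) :
    ∃ C : ℝ, ∀ ξ, ‖fourier f ξ‖ ≤ C := by
  refine ⟨‖((((2 * Real.pi) ^ (-(d : ℝ) / 2) : ℝ) : ℂ))‖ * ∫ x, ‖f x‖, fun ξ => ?_⟩
  unfold fourier
  rw [norm_mul]
  gcongr
  refine (norm_integral_le_integral_norm _).trans (le_of_eq ?_)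
  congr 1
  funext x
  rw [norm_mul, norm_cexp_neg_I_mul, mul_one]

lemma continuous_fourierInv {d : ℕ} {f : (Fin d → ℝ) → ℂ} (hf : Integrable f) :
    Continuous (fourierInv f) := by
  have : fourierInv f = fun ξ => fourier f (-ξ) := funext (fourierInv_eq_fourier_neg f)
  rw [this]
  exact (continuous_fourier hf).comp continuous_neg

lemma exists_norm_fourierInv_le {d : ℕ} (f : (Fin d → ℝ) → ℂ) :
    ∃ C : ℝ, ∀ ξ, ‖fourierInv f ξ‖ ≤ C := by
  obtain ⟨C, hC⟩ := exists_norm_fourier_le f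
  exact ⟨C, fun ξ => by rw [fourierInv_eq_fourier_neg]; exact hC _⟩

/-- The multiplication formula for the Fourier transform. -/
lemma integral_fourier_mul {d : ℕ} {f h : (Fin d → ℝ) → ℂ} (hf : Integrable f)
    (hh : Integrable h) : ∫ ξ, fourier f ξ * h ξ = ∫ x, f x * fourier h x := by
  have hint : Integrable (Function.uncurry fun (ξ x : Fin d → ℝ) =>
      f x * h ξ * Complex.exp (-(Complex.I * ((∑ i, ξ i * x i : ℝ) : ℂ))))
      (volume.prod volume) := by
    have h1 : Integrable (fun z : (Fin d → ℝ) × (Fin d → ℝ) => f z.2 * h z.1)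
        (volume.prod volume) := by
      simpa only [mul_comm] using hh.mul_prod hf
    refine h1.mul_bdd (c := 1) (Continuous.aestronglyMeasurable (by fun_prop))
      (ae_of_all _ fun x => ?_)
    exact (norm_cexp_neg_I_mul _).le
  have key := integral_integral_swap hint
  unfold fourier
  calc _ = (((2 * Real.pi) ^ (-(d : ℝ) / 2) : ℝ) : ℂ) * ∫ ξ, ∫ x, f x * h ξ *
        Complex.exp (-(Complex.I * ((∑ i, ξ i * x i : ℝ) : ℂ))) := by
        rw [← integral_const_mul]
        congr 1
        funext ξ
        rw [mul_assoc, ← integral_mul_const]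
        congr 2
        funext x
        ring
    _ = (((2 * Real.pi) ^ (-(d : ℝ) / 2) : ℝ) : ℂ) * ∫ x, ∫ ξ, f x * h ξ *
        Complex.exp (-(Complex.I * ((∑ i, ξ i * x i : ℝ) : ℂ))) := by rw [key]
    _ = _ := by
        rw [← integral_const_mul]
        congr 1
        funext x
        rw [mul_left_comm]
        congr 1
        rw [← integral_const_mul]
        congr 1
        funext ξ
        simp only [mul_comm (ξ _), mul_assoc]

lemma integral_fourierInv_mul {d : ℕ} {f h : (Fin d → ℝ) → ℂ} (hf : Integrable f)
    (hh : Integrable h) : ∫ ξ, fourierInv f ξ * h ξ = ∫ x, f x * fourierInv h x := by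
  have h1 := integral_fourier_mul hf hh.comp_neg
  rw [← integral_neg_eq_self] at h1
  simp only [neg_neg] at h1
  simp only [fourierInv_eq_fourier_neg]
  rw [h1]
  congr 1
  funext x
  congr 1
  unfold fourier
  congr 1
  rw [← integral_neg_eq_self]
  simp

/-- A function whose inverse Fourier transform `G` lives where the Fourier transform of `k` equals
one is reproduced by convolution with `k`. -/
lemma fourierInv_eq_integral_mul {d : ℕ} {G k : (Fin d → ℝ) → ℂ} (hG : Integrable G)
    (hk : Integrable k)
    (h1 : ∀ ξ, G ξ ≠ 0 →
      ∫ z, k z * Complex.exp (-(Complex.I * ((∑ i, ξ i * z i : ℝ) : ℂ))) = 1) (x : Fin d → ℝ) :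
    fourierInv G x = ∫ y, fourierInv G y * k (x - y) := by
  rw [integral_fourierInv_mul hG (hk.comp_sub_left x)]
  conv_lhs => unfold fourierInv
  rw [← integral_const_mul]
  congr 1
  funext ξ
  by_cases h0 : G ξ = 0
  · simp [h0]
  rw [mul_left_comm]
  congr 1
  unfold fourierInv
  congr 1
  rw [← integral_sub_left_eq_self _ _ x]
  have : ∀ z, k (x - (x - z)) * Complex.exp (Complex.I * ((∑ i, ξ i * (x - z) i : ℝ) : ℂ)) =
      Complex.exp (Complex.I * ((∑ i, x i * ξ i : ℝ) : ℂ)) *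
        (k z * Complex.exp (-(Complex.I * ((∑ i, ξ i * z i : ℝ) : ℂ)))) := by
    intro z
    rw [mul_left_comm, ← Complex.exp_add, sub_sub_cancel]
    congr 2
    simp only [Pi.sub_apply, mul_sub, Finset.sum_sub_distrib, mul_comm (x _)]
    push_cast
    ring
  simp only [this]
  rw [integral_const_mul, h1 ξ h0, mul_one]

/-! ### Fourier inversion for test functions. -/

-- Change of convention: Mathlib's kernel is exp(2πi⟨x, ξ⟩) on Euclidean space, so the frequency is
-- divided by 2π and the normalising constant appears in front.
open FourierTransform in
lemma fourierInv_eq_scaled {d : ℕ} (η : (Fin d → ℝ) → ℂ) (ξ : Fin d → ℝ) :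
    fourierInv η ξ = (((2 * Real.pi) ^ (-(d : ℝ) / 2) : ℝ) : ℂ) *
      𝓕⁻ (fun x : EuclideanSpace ℝ (Fin d) => η (WithLp.ofLp x))
        (WithLp.toLp 2 ((2 * Real.pi)⁻¹ • ξ)) := by
  unfold fourierInv
  congr 1
  rw [Real.fourierInv_eq', ← (PiLp.volume_preserving_ofLp (Fin d)).integral_comp
    (MeasurableEquiv.toLp 2 (Fin d → ℝ)).symm.measurableEmbedding]
  congr 1
  funext x
  rw [smul_eq_mul, mul_comm]
  congr 2
  rw [mul_comm]
  congr 1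
  rw [PiLp.inner_apply, Finset.mul_sum]
  push_cast
  refine Finset.sum_congr rfl fun i _ => ?_
  simp
  field_simp

open FourierTransform SchwartzMap in
lemma exists_schwartz_of_contDiff {d : ℕ} {η : (Fin d → ℝ) → ℂ}
    (h1 : ContDiff ℝ ((⊤ : ℕ∞) : WithTop ℕ∞) η) (h2 : HasCompactSupport η) :
    ∃ g : 𝓢(EuclideanSpace ℝ (Fin d), ℂ), ∀ x, g x = η (WithLp.ofLp x) := by
  let e : EuclideanSpace ℝ (Fin d) ≃L[ℝ] (Fin d → ℝ) := EuclideanSpace.equiv (Fin d) ℝ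
  have c1 : ContDiff ℝ ((⊤ : ℕ∞) : WithTop ℕ∞) (fun x => η (e x)) := h1.comp e.contDiff
  have c2 : HasCompactSupport (fun x => η (e x)) := h2.comp_homeomorph e.toHomeomorph
  exact ⟨c2.toSchwartzMap c1, fun x => rfl⟩

open FourierTransform SchwartzMap in
lemma integrable_fourierInv {d : ℕ} {η : (Fin d → ℝ) → ℂ}
    (h1 : ContDiff ℝ ((⊤ : ℕ∞) : WithTop ℕ∞) η) (h2 : HasCompactSupport η) :
    Integrable (fourierInv η) := by
  obtain ⟨g, hg⟩ := exists_schwartz_of_contDiff h1 h2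
  have hg' : (fun x : EuclideanSpace ℝ (Fin d) => η (WithLp.ofLp x)) = g := funext fun x => (hg x).symm
  have : fourierInv η = fun ξ => (((2 * Real.pi) ^ (-(d : ℝ) / 2) : ℝ) : ℂ) *
      (𝓕⁻ g : 𝓢(EuclideanSpace ℝ (Fin d), ℂ)) (WithLp.toLp 2 ((2 * Real.pi)⁻¹ • ξ)) := by
    funext ξ
    rw [fourierInv_eq_scaled, SchwartzMap.fourierInv_coe]
    simp only [hg']
  rw [this]
  refine Integrable.const_mul ?_ _
  have h3 : Integrable (fun ξ : Fin d → ℝ =>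
      (𝓕⁻ g : 𝓢(EuclideanSpace ℝ (Fin d), ℂ)) (WithLp.toLp 2 ξ)) :=
    (PiLp.volume_preserving_toLp (Fin d)).integrable_comp_of_integrable
      (SchwartzMap.integrable _)
  exact h3.comp_smul (R := (2 * Real.pi)⁻¹) (by positivity)

open FourierTransform SchwartzMap in
/-- Fourier inversion for smooth compactly supported functions. -/
lemma fourier_fourierInv {d : ℕ} {η : (Fin d → ℝ) → ℂ}
    (h1 : ContDiff ℝ ((⊤ : ℕ∞) : WithTop ℕ∞) η) (h2 : HasCompactSupport η) (x : Fin d → ℝ) :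
    fourier (fourierInv η) x = η x := by
  obtain ⟨g, hg⟩ := exists_schwartz_of_contDiff h1 h2
  have hg' : (fun x : EuclideanSpace ℝ (Fin d) => η (WithLp.ofLp x)) = g := funext fun x => (hg x).symm
  have h2pi : (0 : ℝ) < 2 * Real.pi := by positivity
  have hinv : 𝓕 (𝓕⁻ (g : EuclideanSpace ℝ (Fin d) → ℂ)) = g := by
    rw [← SchwartzMap.fourierInv_coe, ← SchwartzMap.fourier_coe, fourier_fourierInv_eq]
  have hx : η x = 𝓕 (𝓕⁻ (g : EuclideanSpace ℝ (Fin d) → ℂ)) (WithLp.toLp 2 x) := by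
    rw [hinv, hg]
  have hscale := Measure.integral_comp_inv_smul (volume : Measure (Fin d → ℝ))
    (fun ξ => 𝓕⁻ (g : EuclideanSpace ℝ (Fin d) → ℂ) (WithLp.toLp 2 ξ) *
      Complex.exp (-(Complex.I * ((∑ i, x i * (2 * Real.pi * ξ i) : ℝ) : ℂ)))) (2 * Real.pi)
  -- The two normalising constants cancel the Jacobian of the rescaling by 2π.
  have hconst : (((2 * Real.pi) ^ (-(d : ℝ) / 2) : ℝ) : ℂ) *
      (((2 * Real.pi) ^ (-(d : ℝ) / 2) : ℝ) : ℂ) * (((2 * Real.pi) ^ d : ℝ) : ℂ) = 1 := by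
    rw [← Complex.ofReal_mul, ← Complex.ofReal_mul, ← Real.rpow_natCast, ← Real.rpow_add h2pi,
      ← Real.rpow_add h2pi]
    ring_nf
    simp
  have hE : 𝓕 (𝓕⁻ (g : EuclideanSpace ℝ (Fin d) → ℂ)) (WithLp.toLp 2 x) =
      ∫ ξ : Fin d → ℝ, 𝓕⁻ (g : EuclideanSpace ℝ (Fin d) → ℂ) (WithLp.toLp 2 ξ) *
      Complex.exp (-(Complex.I * ((∑ i, x i * (2 * Real.pi * ξ i) : ℝ) : ℂ))) := by
    rw [Real.fourier_eq', ← (PiLp.volume_preserving_toLp (Fin d)).integral_comp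
      (MeasurableEquiv.toLp 2 (Fin d → ℝ)).measurableEmbedding]
    congr 1
    funext ξ
    rw [smul_eq_mul, mul_comm]
    congr 2
    rw [PiLp.inner_apply, mul_comm Complex.I, ← neg_mul]
    congr 1
    rw [Finset.mul_sum, ← Complex.ofReal_neg, ← Finset.sum_neg_distrib]
    congr 1
    refine Finset.sum_congr rfl fun i _ => ?_
    simp
    ring
  rw [hx, hE]
  unfold fourier
  have hI : ∀ ξ : Fin d → ℝ, fourierInv η ξ *
      Complex.exp (-(Complex.I * ((∑ i, x i * ξ i : ℝ) : ℂ))) =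
      (((2 * Real.pi) ^ (-(d : ℝ) / 2) : ℝ) : ℂ) *
      (𝓕⁻ (g : EuclideanSpace ℝ (Fin d) → ℂ) (WithLp.toLp 2 ((2 * Real.pi)⁻¹ • ξ)) *
      Complex.exp (-(Complex.I *
        ((∑ i, x i * (2 * Real.pi * ((2 * Real.pi)⁻¹ • ξ) i) : ℝ) : ℂ)))) := by
    intro ξ
    rw [fourierInv_eq_scaled, hg', mul_assoc]
    congr 6
    refine Finset.sum_congr rfl fun i _ => ?_
    rw [Pi.smul_apply, smul_eq_mul, mul_inv_cancel_left₀ h2pi.ne']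
  simp only [hI]
  rw [integral_const_mul, hscale, Module.finrank_fintype_fun_eq_card, Fintype.card_fin,
    abs_of_pos (by positivity), Complex.real_smul, ← mul_assoc, ← mul_assoc, hconst, one_mul]

/-! ### The reproducing kernel and its dyadic dilations. -/

open FourierTransform SchwartzMap in
/-- A Schwartz function whose Fourier transform (without normalisation) is one on `[-2, 2]`. -/
lemma exists_schwartz_fourier_eq_one :
    ∃ Ψ : 𝓢(ℝ, ℂ), ∀ ξ : ℝ, |ξ| ≤ 2 →
      ∫ z : ℝ, Ψ z * Complex.exp (-(Complex.I * ((ξ * z : ℝ) : ℂ))) = 1 := by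
  -- Radius 1 suffices: in Mathlib's convention |ξ| ≤ 2 becomes |ξ / (2π)| ≤ 1/π < 1.
  let b : ContDiffBump (0 : ℝ) := ⟨1, 2, one_pos, one_lt_two⟩
  have c1 : ContDiff ℝ ((⊤ : ℕ∞) : WithTop ℕ∞) (fun x : ℝ => ((b x : ℝ) : ℂ)) :=
    Complex.ofRealCLM.contDiff.comp b.contDiff
  have c2 : HasCompactSupport (fun x : ℝ => ((b x : ℝ) : ℂ)) :=
    b.hasCompactSupport.comp_left (g := fun t : ℝ => (t : ℂ)) Complex.ofReal_zero
  let χ : 𝓢(ℝ, ℂ) := c2.toSchwartzMap c1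
  refine ⟨𝓕⁻ χ, fun ξ hξ => ?_⟩
  have h1 : 𝓕 ((𝓕⁻ χ : 𝓢(ℝ, ℂ)) : ℝ → ℂ) (ξ / (2 * Real.pi)) = 1 := by
    rw [← SchwartzMap.fourier_coe, fourier_fourierInv_eq]
    change ((b (ξ / (2 * Real.pi)) : ℝ) : ℂ) = 1
    rw [b.one_of_mem_closedBall, Complex.ofReal_one]
    change ξ / (2 * Real.pi) ∈ Metric.closedBall (0 : ℝ) 1
    rw [mem_closedBall_zero_iff, Real.norm_eq_abs, abs_div, abs_of_pos (by positivity : 0 < 2 * Real.pi),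
      div_le_one (by positivity)]
    linarith [Real.pi_gt_three]
  rw [← h1, Real.fourier_eq']
  congr 1
  funext z
  rw [smul_eq_mul, mul_comm]
  congr 2
  have : (2 * Real.pi : ℂ) ≠ 0 := by simp [Real.pi_ne_zero]
  simp
  field_simp

/-- The `L₁`-normalised dyadic dilation. -/
noncomputable def dilate (Ψ : ℝ → ℂ) (n : ℕ) (z : ℝ) : ℂ := (2 : ℂ) ^ n * Ψ ((2 : ℝ) ^ n * z)

lemma integrable_dilate {Ψ : ℝ → ℂ} (hΨ : Integrable Ψ) (n : ℕ) : Integrable (dilate Ψ n) :=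
  (hΨ.comp_mul_left' (by positivity)).const_mul _

lemma lintegral_enorm_dilate {Ψ : ℝ → ℂ} (hΨ : Integrable Ψ) (n : ℕ) :
    ∫⁻ z, ‖dilate Ψ n z‖ₑ = ∫⁻ z, ‖Ψ z‖ₑ := by
  rw [← ofReal_integral_norm_eq_lintegral_enorm (integrable_dilate hΨ n),
    ← ofReal_integral_norm_eq_lintegral_enorm hΨ]
  congr 1
  simp only [dilate, norm_mul, norm_pow, Complex.norm_ofNat]
  rw [integral_const_mul, Measure.integral_comp_mul_left (fun z => ‖Ψ z‖),
    abs_of_pos (by positivity), smul_eq_mul, mul_inv_cancel_left₀ (by positivity)]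

lemma integral_dilate_mul_cexp {Ψ : ℝ → ℂ} (h : ∀ ξ : ℝ, |ξ| ≤ 2 →
      ∫ z : ℝ, Ψ z * Complex.exp (-(Complex.I * ((ξ * z : ℝ) : ℂ))) = 1) (n : ℕ) (ξ : ℝ)
      (hξ : |ξ| ≤ 2 ^ (n + 1)) :
    ∫ z : ℝ, dilate Ψ n z * Complex.exp (-(Complex.I * ((ξ * z : ℝ) : ℂ))) = 1 := by
  have h2 : (0 : ℝ) < (2 : ℝ) ^ n := by positivity
  have h3 : |ξ / 2 ^ n| ≤ 2 := by
    rw [abs_div, abs_of_pos h2, div_le_iff₀ h2]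
    rw [pow_succ] at hξ
    linarith
  have := Measure.integral_comp_mul_left (fun z : ℝ => Ψ z *
    Complex.exp (-(Complex.I * ((ξ / 2 ^ n * z : ℝ) : ℂ)))) ((2 : ℝ) ^ n)
  rw [h _ h3] at this
  unfold dilate
  simp only [mul_assoc]
  rw [integral_const_mul]
  have e : ∀ z : ℝ, ξ / 2 ^ n * (2 ^ n * z) = ξ * z := fun z => by field_simp
  simp only [e] at this
  rw [this, abs_of_pos (by positivity)]
  simp

/-- Differentiation costs a factor 2^n while the L_1 norm of a dilate does not change; this is the
only source of the growth 2^n in the sampling bounds. -/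
lemma hasDerivAt_dilate {Ψ Ψ' : ℝ → ℂ} (h : ∀ x, HasDerivAt Ψ (Ψ' x) x) (n : ℕ) (x : ℝ) :
    HasDerivAt (dilate Ψ n) ((2 : ℂ) ^ n * dilate Ψ' n x) x := by
  unfold dilate
  have h1 : HasDerivAt (fun z : ℝ => (2 : ℝ) ^ n * z) ((2 : ℝ) ^ n) x := by
    simpa using (hasDerivAt_id x).const_mul ((2 : ℝ) ^ n)
  have := ((h ((2 : ℝ) ^ n * x)).scomp x h1).const_mul ((2 : ℂ) ^ n)
  rw [Complex.real_smul] at this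
  exact_mod_cast this

lemma enorm_sub_le_lintegral_deriv {ψ ψ' : ℝ → ℂ} (h : ∀ x, HasDerivAt ψ (ψ' x) x)
    (hc : Continuous ψ') {a b : ℝ} (hab : a ≤ b) :
    ‖ψ b - ψ a‖ₑ ≤ ∫⁻ x in Set.Ioc a b, ‖ψ' x‖ₑ := by
  rw [← intervalIntegral.integral_eq_sub_of_hasDerivAt (fun x _ => h x) (hc.intervalIntegrable a b),
    intervalIntegral.integral_of_le hab]
  exact enorm_integral_le_lintegral_enorm _

/-! ### One-dimensional sampling and difference estimates. -/

lemma tsum_lintegral_Ioc_eq (u : ℝ → ℝ≥0∞) {p : ℝ} (hp : 0 < p) (a : ℝ) :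
    ∑' k : ℤ, ∫⁻ x in Set.Ioc (a + k * p) (a + (k + 1) * p), u x = ∫⁻ x, u x := by
  have h1 := iUnion_Ioc_add_zsmul hp a
  have h2 := Set.pairwise_disjoint_Ioc_add_zsmul a p
  simp only [zsmul_eq_mul, Int.cast_add, Int.cast_one] at h1 h2
  rw [← lintegral_iUnion (fun _ => measurableSet_Ioc) h2, h1, setLIntegral_univ]

lemma secondDiff_apply {E : Type*} [AddCommMonoid E] (h x : E) (u : E → ℂ) :
    (fwdDiff h)^[2] u x = u (x + h + h) - u (x + h) - (u (x + h) - u x) := rfl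

/-- The k-th difference is controlled by the variation over an interval of length 2h starting at its
sampling point, and these intervals tile the line. Hence no constant depends on h. -/
lemma tsum_enorm_secondDiff_le {ψ ψ' : ℝ → ℂ} (hd : ∀ x, HasDerivAt ψ (ψ' x) x)
    (hc : Continuous ψ') {h : ℝ} (hh : 0 < h) (y : ℝ) :
    ∑' k : ℤ, ‖(fwdDiff h)^[2] ψ (2 * h * k - y)‖ₑ ≤ ∫⁻ x, ‖ψ' x‖ₑ := by
  rw [← tsum_lintegral_Ioc_eq (fun x => ‖ψ' x‖ₑ) (by positivity : 0 < 2 * h) (-y)]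
  refine ENNReal.tsum_le_tsum fun k => ?_
  rw [secondDiff_apply]
  have e1 : -y + (k : ℝ) * (2 * h) = 2 * h * k - y := by ring
  have e2 : -y + ((k : ℝ) + 1) * (2 * h) = 2 * h * k - y + h + h := by ring
  rw [e1, e2]
  set x := 2 * h * k - y
  have hU : Set.Ioc x (x + h + h) = Set.Ioc x (x + h) ∪ Set.Ioc (x + h) (x + h + h) :=
    (Set.Ioc_union_Ioc_eq_Ioc (by linarith) (by linarith)).symm
  rw [hU, lintegral_union measurableSet_Ioc (Set.Ioc_disjoint_Ioc_of_le le_rfl),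
    add_comm (∫⁻ t in Set.Ioc x (x + h), ‖ψ' t‖ₑ)]
  exact (enorm_sub_le).trans (add_le_add
    (enorm_sub_le_lintegral_deriv hd hc (le_add_of_nonneg_right hh.le))
    (enorm_sub_le_lintegral_deriv hd hc (le_add_of_nonneg_right hh.le)))

/-- Without a difference a sample is not controlled by variation alone: on each unit cell it is at
most the mean of |ψ| plus the variation. This serves the level -1. -/
lemma tsum_enorm_int_le {ψ ψ' : ℝ → ℂ} (hd : ∀ x, HasDerivAt ψ (ψ' x) x)
    (hc : Continuous ψ') (y : ℝ) :
    ∑' k : ℤ, ‖ψ (k - y)‖ₑ ≤ (∫⁻ x, ‖ψ x‖ₑ) + ∫⁻ x, ‖ψ' x‖ₑ := by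
  have hψ : Continuous ψ := continuous_iff_continuousAt.2 fun x => (hd x).continuousAt
  rw [← tsum_lintegral_Ioc_eq (fun x => ‖ψ' x‖ₑ) one_pos (-y),
    ← tsum_lintegral_Ioc_eq (fun x => ‖ψ x‖ₑ) one_pos (-y), ← ENNReal.tsum_add]
  refine ENNReal.tsum_le_tsum fun k => ?_
  have e1 : -y + (k : ℝ) * 1 = k - y := by ring
  have e2 : -y + ((k : ℝ) + 1) * 1 = k - y + 1 := by ring
  rw [e1, e2]
  set x := k - y
  have hvol : volume (Set.Ioc x (x + 1)) = 1 := by simp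
  calc ‖ψ x‖ₑ = ∫⁻ _ in Set.Ioc x (x + 1), ‖ψ x‖ₑ := by simp
    _ ≤ ∫⁻ t in Set.Ioc x (x + 1), (‖ψ t‖ₑ + ∫⁻ s in Set.Ioc x (x + 1), ‖ψ' s‖ₑ) := by
        refine setLIntegral_mono' measurableSet_Ioc fun t ht => ?_
        have : ψ x = ψ t - (ψ t - ψ x) := by ring
        rw [this]
        refine enorm_sub_le.trans (add_le_add ?_ ?_)
        · exact le_rfl
        refine (enorm_sub_le_lintegral_deriv hd hc ht.1.le).trans ?_
        exact lintegral_mono_set (Set.Ioc_subset_Ioc_right ht.2)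
    _ = _ := by
        rw [lintegral_add_left hψ.enorm.measurable]
        simp

lemma lintegral_enorm_secondDiff_le {ψ : ℝ → ℂ} (hψ : Continuous ψ) (h a : ℝ) :
    ∫⁻ y, ‖(fwdDiff h)^[2] ψ (a - y)‖ₑ ≤ 4 * ∫⁻ z, ‖ψ z‖ₑ := by
  have hs : ∀ b : ℝ, ∫⁻ y, ‖ψ (a - y + b)‖ₑ = ∫⁻ z, ‖ψ z‖ₑ := by
    intro b
    have := lintegral_sub_left_eq_self (μ := (volume : Measure ℝ)) (fun z => ‖ψ z‖ₑ) (a + b)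
    rw [← this]
    congr 1
    funext y
    congr 2
    ring
  calc _ ≤ ∫⁻ y, (‖ψ (a - y + (h + h))‖ₑ + ‖ψ (a - y + h)‖ₑ + (‖ψ (a - y + h)‖ₑ + ‖ψ (a - y + 0)‖ₑ)) := by
        refine lintegral_mono fun y => ?_
        rw [secondDiff_apply, add_zero, add_assoc]
        exact enorm_sub_le.trans (add_le_add enorm_sub_le enorm_sub_le)
    _ = _ := by
        have hm : ∀ b : ℝ, Measurable fun y => ‖ψ (a - y + b)‖ₑ := fun b =>
          (hψ.comp (by fun_prop : Continuous fun y => a - y + b)).enorm.measurable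
        rw [lintegral_add_left (f := fun y => ‖ψ (a - y + (h + h))‖ₑ + ‖ψ (a - y + h)‖ₑ)
          (by exact (hm _).add (hm _)), lintegral_add_left (hm _),
          lintegral_add_left (hm _), hs, hs, hs]
        ring

/-! ### Schur's test and tensor products. -/

lemma lintegral_mul_rpow_le {X : Type*} [MeasurableSpace X] {μ : Measure X} {K u : X → ℝ≥0∞}
    (hK : AEMeasurable K μ) (hu : AEMeasurable u μ) {p : ℝ} (hp : 1 ≤ p) :
    (∫⁻ y, K y * u y ∂μ) ^ p ≤ (∫⁻ y, K y ∂μ) ^ (p - 1) * ∫⁻ y, K y * u y ^ p ∂μ := by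
  rcases hp.eq_or_lt with rfl | hp
  · simp
  have hp0 : 0 < p := by linarith
  have hpq := Real.HolderConjugate.conjExponent hp
  set q := p.conjExponent
  have hq0 : 0 < q := hpq.symm.pos
  have hsum : 1 / q + 1 / p = 1 := by
    have := hpq.inv_add_inv_eq_one
    rw [one_div, one_div, add_comm]; exact this
  -- Hölder for the splitting K u = K^{1/q} · (K^{1/p} u).
  have h := ENNReal.lintegral_mul_le_Lp_mul_Lq μ hpq.symm (hK.pow_const (1 / q))
    ((hK.pow_const (1 / p)).mul hu)
  have e1 : ∀ y, ((fun y => K y ^ (1 / q)) * ((fun y => K y ^ (1 / p)) * u)) y = K y * u y := by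
    intro y
    simp only [Pi.mul_apply]
    rw [← mul_assoc, ← ENNReal.rpow_add_of_nonneg _ _ (by positivity) (by positivity), hsum,
      ENNReal.rpow_one]
  have e2 : ∀ y, (K y ^ (1 / q)) ^ q = K y := by
    intro y
    rw [← ENNReal.rpow_mul, one_div_mul_cancel hq0.ne', ENNReal.rpow_one]
  have e3 : ∀ y, (((fun y => K y ^ (1 / p)) * u) y) ^ p = K y * u y ^ p := by
    intro y
    simp only [Pi.mul_apply]
    rw [ENNReal.mul_rpow_of_nonneg _ _ hp0.le, ← ENNReal.rpow_mul, one_div_mul_cancel hp0.ne',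
      ENNReal.rpow_one]
  simp only [e1, e2, e3] at h
  refine (ENNReal.rpow_le_rpow h hp0.le).trans (le_of_eq ?_)
  rw [ENNReal.mul_rpow_of_nonneg _ _ hp0.le, ← ENNReal.rpow_mul, ← ENNReal.rpow_mul,
    one_div_mul_cancel hp0.ne', ENNReal.rpow_one]
  congr 2
  have : 1 / q = 1 - 1 / p := by linarith
  rw [this]
  field_simp

/-- Schur's test for operators from `L_p` to `ℓ_p`. -/
lemma tsum_lintegral_mul_rpow_le {ι X : Type*} [Countable ι] [MeasurableSpace X] {μ : Measure X}
    {K : ι → X → ℝ≥0∞} {u : X → ℝ≥0∞} (hK : ∀ k, AEMeasurable (K k) μ) (hu : AEMeasurable u μ)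
    {p : ℝ} (hp : 1 ≤ p) {A B : ℝ≥0∞} (hA : ∀ k, ∫⁻ y, K k y ∂μ ≤ A)
    (hB : ∀ y, ∑' k, K k y ≤ B) :
    ∑' k, (∫⁻ y, K k y * u y ∂μ) ^ p ≤ A ^ (p - 1) * (B * ∫⁻ y, u y ^ p ∂μ) := by
  have hup : AEMeasurable (fun y => u y ^ p) μ := hu.pow_const p
  calc _ ≤ ∑' k, A ^ (p - 1) * ∫⁻ y, K k y * u y ^ p ∂μ := by
        refine ENNReal.tsum_le_tsum fun k => (lintegral_mul_rpow_le (hK k) hu hp).trans ?_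
        gcongr
        exact hA k
    _ = A ^ (p - 1) * ∫⁻ y, (∑' k, K k y) * u y ^ p ∂μ := by
        have := lintegral_tsum (f := fun k y => K k y * u y ^ p) fun k => (hK k).mul hup
        rw [ENNReal.tsum_mul_left, ← this]
        simp only [ENNReal.tsum_mul_right]
    _ ≤ A ^ (p - 1) * ∫⁻ y, B * u y ^ p ∂μ := by
        gcongr with y
        exact hB y
    _ = _ := by rw [lintegral_const_mul'' _ hup]

/-- Every finite set of multi-indices lies in a box, over which the sum of products factorises. -/
lemma tsum_pi_prod_le {d : ℕ} {κ : Type*} (a : Fin d → κ → ℝ≥0∞) :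
    ∑' k : Fin d → κ, ∏ i, a i (k i) ≤ ∏ i, ∑' m, a i m := by
  classical
  rw [ENNReal.tsum_eq_iSup_sum]
  refine iSup_le fun s => ?_
  let t : Fin d → Finset κ := fun i => s.image fun k => k i
  calc ∑ k ∈ s, ∏ i, a i (k i) ≤ ∑ k ∈ Fintype.piFinset t, ∏ i, a i (k i) := by
        refine Finset.sum_le_sum_of_subset fun k hk => ?_
        exact Fintype.mem_piFinset.2 fun i => Finset.mem_image_of_mem _ hk
    _ = ∏ i, ∑ m ∈ t i, a i m := (Finset.prod_univ_sum t a).symm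
    _ ≤ _ := Finset.prod_le_prod' fun i _ => ENNReal.sum_le_tsum _

lemma lintegral_prod_enorm {d : ℕ} {u : Fin d → ℝ → ℂ} (hu : ∀ i, Integrable (u i)) :
    ∫⁻ y : Fin d → ℝ, ∏ i, ‖u i (y i)‖ₑ = ∏ i, ∫⁻ t, ‖u i t‖ₑ := by
  have h1 : Integrable fun y : Fin d → ℝ => ∏ i, u i (y i) := Integrable.fintype_prod hu
  have e : ∀ y : Fin d → ℝ, ∏ i, ‖u i (y i)‖ₑ = ‖∏ i, u i (y i)‖ₑ := fun y => by
    simp only [enorm_eq_nnnorm, nnnorm_prod, ENNReal.ofNNReal_finsetProd]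
  simp only [e]
  rw [← ofReal_integral_norm_eq_lintegral_enorm h1]
  simp only [norm_prod]
  rw [integral_fintype_prod_volume_eq_prod (fun i t => ‖u i t‖),
    ENNReal.ofReal_prod_of_nonneg fun i _ => integral_nonneg fun _ => norm_nonneg _]
  exact Finset.prod_congr rfl fun i _ => ofReal_integral_norm_eq_lintegral_enorm (hu i)

/-! ### Mixed differences of tensor products and convolutions. -/

/-- A mixed difference is a finite linear combination of translations. -/
lemma exists_mixedDiff_eq_sum {d : ℕ} (e : Finset (Fin d)) (h : Fin d → ℝ) :
    ∃ (ι : Type) (_ : Fintype ι) (c : ι → ℂ) (v : ι → Fin d → ℝ),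
      ∀ f x, mixedDiff e h f x = ∑ a, c a * f (x + v a) := by
  unfold mixedDiff
  induction List.finRange d with
  | nil => exact ⟨Unit, inferInstance, fun _ => 1, fun _ => 0, fun f x => by simp⟩
  | cons i L ih =>
    obtain ⟨ι, _, c, v, hcv⟩ := ih
    by_cases hi : i ∈ e
    · refine ⟨Fin 3 × ι, inferInstance, fun a => (![1, -2, 1] : Fin 3 → ℂ) a.1 * c a.2,
        fun a => (![Pi.single i (h i) + Pi.single i (h i), Pi.single i (h i), 0] :
          Fin 3 → Fin d → ℝ) a.1 + v a.2, fun f x => ?_⟩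
      rw [List.foldr_cons, if_pos hi, secondDiff_apply, hcv, hcv, hcv, Fintype.sum_prod_type,
        Fin.sum_univ_three]
      simp only [Matrix.cons_val_zero, Matrix.cons_val_one, Matrix.cons_val, one_mul, zero_add,
        ← add_assoc, mul_assoc, ← Finset.mul_sum]
      ring
    · refine ⟨ι, inferInstance, c, v, fun f x => ?_⟩
      rw [List.foldr_cons, if_neg hi, hcv]

lemma fwdDiff_single_prod {d : ℕ} (w : Fin d → ℝ → ℂ) (i : Fin d) (a : ℝ) :
    fwdDiff (Pi.single i a : Fin d → ℝ) (fun x => ∏ j, w j (x j)) =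
      fun x => ∏ j, (Function.update w i (fwdDiff a (w i))) j (x j) := by
  funext x
  rw [fwdDiff, ← Finset.mul_prod_erase _ _ (Finset.mem_univ i), ← Finset.mul_prod_erase _ _ (Finset.mem_univ i),
    ← Finset.mul_prod_erase _ _ (Finset.mem_univ i)]
  have e1 : ∀ j ∈ Finset.univ.erase i, w j ((x + Pi.single i a : Fin d → ℝ) j) = w j (x j) := by
    intro j hj
    simp [Finset.ne_of_mem_erase hj]
  have e2 : ∀ j ∈ Finset.univ.erase i, Function.update w i (fwdDiff a (w i)) j (x j) = w j (x j) := by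
    intro j hj
    rw [Function.update_of_ne (Finset.ne_of_mem_erase hj)]
  rw [Finset.prod_congr rfl e1, Finset.prod_congr rfl e2, ← sub_mul]
  simp [fwdDiff]

lemma mixedDiff_prod {d : ℕ} (e : Finset (Fin d)) (h : Fin d → ℝ) (u : Fin d → ℝ → ℂ) :
    mixedDiff e h (fun x => ∏ i, u i (x i)) =
      fun x => ∏ i, (if i ∈ e then (fwdDiff (h i))^[2] (u i) else u i) (x i) := by
  -- Generalised to arbitrary lists for the induction; `Nodup` ensures that no coordinate is
  -- differenced twice.
  have key : ∀ L : List (Fin d), L.Nodup →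
      L.foldr (fun i g => if i ∈ e then (fwdDiff (Pi.single i (h i) : Fin d → ℝ))^[2] g else g)
        (fun x => ∏ i, u i (x i)) =
      fun x => ∏ i, (if i ∈ L ∧ i ∈ e then (fwdDiff (h i))^[2] (u i) else u i) (x i) := by
    intro L
    induction L with
    | nil => intro _; simp
    | cons i L ih =>
      intro hL
      rw [List.nodup_cons] at hL
      rw [List.foldr_cons, ih hL.2]
      by_cases hi : i ∈ e
      · rw [if_pos hi, Function.iterate_succ_apply, Function.iterate_one,
          fwdDiff_single_prod (fun j => if j ∈ L ∧ j ∈ e then (fwdDiff (h j))^[2] (u j) else u j),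
          fwdDiff_single_prod]
        funext x
        refine Finset.prod_congr rfl fun j _ => ?_
        by_cases hj : j = i
        · subst hj
          simp [hL.1, hi]
        · simp [hj]
      · rw [if_neg hi]
        funext x
        refine Finset.prod_congr rfl fun j _ => ?_
        by_cases hj : j = i
        · subst hj
          simp [hi]
        · simp [hj]
  unfold mixedDiff
  rw [key _ (List.nodup_finRange d)]
  simp

/-- Translating a convolution translates only its kernel, so finite combinations of translations
pass to the kernel. -/
lemma mixedDiff_integral {d : ℕ} (e : Finset (Fin d)) (h : Fin d → ℝ) {F k : (Fin d → ℝ) → ℂ}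
    (hF : ∀ x, F x = ∫ y, F y * k (x - y)) (hint : ∀ x, Integrable fun y => F y * k (x - y))
    (x : Fin d → ℝ) : mixedDiff e h F x = ∫ y, F y * mixedDiff e h k (x - y) := by
  obtain ⟨ι, _, c, v, hcv⟩ := exists_mixedDiff_eq_sum e h
  simp only [hcv]
  simp only [Finset.mul_sum]
  rw [integral_finsetSum]
  · refine Finset.sum_congr rfl fun a _ => ?_
    rw [hF, ← integral_const_mul]
    congr 1
    funext y
    rw [add_sub_right_comm]
    ring
  · intro a _
    have := (hint (x + v a)).const_mul (c a)
    refine this.congr (ae_of_all _ fun y => ?_)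
    simp only [add_sub_right_comm]
    ring

/-! ### Uniform bounds for the level kernels. -/

/-- The one-dimensional kernel at level `m`. -/
noncomputable def levelKernel (Ψ : ℝ → ℂ) (m : ℤ) (n : ℕ) : ℝ → ℂ :=
  if m ≠ -1 then (fwdDiff ((2 : ℝ) ^ (-(m + 1))))^[2] (dilate Ψ n) else dilate Ψ n

lemma integrable_levelKernel {Ψ : ℝ → ℂ} (hΨ : Integrable Ψ) (m : ℤ) (n : ℕ) :
    Integrable (levelKernel Ψ m n) := by
  have hd := integrable_dilate hΨ n
  unfold levelKernel
  split_ifs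
  · have : ∀ g : ℝ → ℂ, Integrable g → ∀ h, Integrable (fwdDiff h g) :=
      fun g hg h => (hg.comp_add_right h).sub hg
    exact this _ (this _ hd _) _
  · exact hd

/-- These are the two inputs of Schur's test in one variable. For m ≥ 0 the grid spacing 2^{-m} is
twice the step 2^{-(m+1)}, so the intervals tile; for m = -1 the integer grid is used. -/
lemma exists_levelKernel_bound {Ψ Ψ' : ℝ → ℂ} (hΨ : Integrable Ψ)
    (hΨ' : Integrable Ψ') (hd : ∀ x, HasDerivAt Ψ (Ψ' x) x) (hc : Continuous Ψ') :
    ∃ C : ℝ≥0, 1 ≤ C ∧ ∀ (m : ℤ) (n : ℕ), -1 ≤ m →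
      (∀ a : ℝ, ∫⁻ y, ‖levelKernel Ψ m n (a - y)‖ₑ ≤ C) ∧
      ∀ y : ℝ, ∑' k : ℤ, ‖levelKernel Ψ m n ((2 : ℝ) ^ (-(max m 0)) * k - y)‖ₑ ≤ C * 2 ^ n := by
  have hcΨ : Continuous Ψ := continuous_iff_continuousAt.2 fun x => (hd x).continuousAt
  set I := ∫⁻ x, ‖Ψ x‖ₑ with hI
  set I' := ∫⁻ x, ‖Ψ' x‖ₑ with hI'
  have hIfin : I ≠ ∞ := hΨ.2.ne
  have hIfin' : I' ≠ ∞ := hΨ'.2.ne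
  have hder : ∀ n x, HasDerivAt (dilate Ψ n) ((2 : ℂ) ^ n * dilate Ψ' n x) x :=
    fun n x => hasDerivAt_dilate hd n x
  have hderc : ∀ n, Continuous fun x => (2 : ℂ) ^ n * dilate Ψ' n x := by
    intro n
    unfold dilate
    fun_prop
  have hdc : ∀ n, Continuous (dilate Ψ n) := by
    intro n
    unfold dilate
    fun_prop
  have hderI : ∀ n : ℕ, ∫⁻ x, ‖(2 : ℂ) ^ n * dilate Ψ' n x‖ₑ = 2 ^ n * I' := by
    intro n
    simp only [enorm_mul]
    rw [lintegral_const_mul' _ _ (by simp), lintegral_enorm_dilate hΨ']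
    congr 1
    rw [enorm_pow]
    congr 1
    simp [enorm_eq_nnnorm]
  -- The 4 is the sum 1 + 2 + 1 of the absolute weights of a second difference, `I'` pays for the
  -- variation, and the summand 1 keeps the constant positive.
  refine ⟨1 + 4 * I.toNNReal + I'.toNNReal, by rw [add_assoc]; exact le_self_add, fun m n hm => ?_⟩
  push_cast
  rw [ENNReal.coe_toNNReal hIfin, ENNReal.coe_toNNReal hIfin']
  have h1n : (1 : ℝ≥0∞) ≤ 2 ^ n := one_le_pow₀ one_le_two
  have hA : 4 * I ≤ 1 + 4 * I + I' := le_add_right le_add_self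
  constructor
  · intro a
    refine le_trans ?_ hA
    unfold levelKernel
    split_ifs
    · exact (lintegral_enorm_secondDiff_le (hdc n) _ a).trans
        (by rw [lintegral_enorm_dilate hΨ])
    · rw [lintegral_sub_left_eq_self (fun z => ‖dilate Ψ n z‖ₑ) a, lintegral_enorm_dilate hΨ]
      exact le_mul_of_one_le_left' (by norm_num)
  · intro y
    unfold levelKernel
    split_ifs with h
    · have hm0 : 0 ≤ m := by omega
      have e : (2 : ℝ) ^ (-(max m 0)) = 2 * (2 : ℝ) ^ (-(m + 1)) := by
        rw [max_eq_left hm0, ← zpow_one_add₀ (by norm_num)]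
        congr 1
        ring
      rw [e]
      refine (tsum_enorm_secondDiff_le (hder n) (hderc n) (by positivity) y).trans ?_
      rw [hderI, mul_comm]
      gcongr
      exact le_add_self
    · have hm1 : m = -1 := by omega
      subst hm1
      simp only [Int.reduceNeg, Left.neg_nonpos_iff, zero_le_one, sup_of_le_right, neg_zero, zpow_zero, one_mul]
      refine (tsum_enorm_int_le (hder n) (hderc n) y).trans ?_
      rw [hderI, lintegral_enorm_dilate hΨ, add_mul]
      refine add_le_add ?_ (mul_comm _ _).le
      calc I ≤ (1 + 4 * I) * 1 := by
            rw [mul_one]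
            exact (le_mul_of_one_le_left' (by norm_num)).trans le_add_self
        _ ≤ _ := by gcongr

/-! ### Building blocks and their sampled differences. -/

namespace IsDyadicDecomposition

variable {φ : ℕ → ℝ → ℂ}

lemma abs_le_of_ne_zero (hφ : IsDyadicDecomposition φ) {n : ℕ} {x : ℝ} (h : φ n x ≠ 0) :
    |x| ≤ 2 ^ (n + 1) := by
  have hx : x ∈ tsupport (φ n) := subset_tsupport _ h
  rcases Nat.eq_zero_or_pos n with rfl | hn
  · simpa using hφ.support_zero hx
  · exact_mod_cast (hφ.support_pos n hn hx).2

lemma le_abs_of_ne_zero (hφ : IsDyadicDecomposition φ) {n : ℕ} {x : ℝ} (h : φ (n + 1) x ≠ 0) :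
    2 ^ n ≤ |x| := by
  have hx : x ∈ tsupport (φ (n + 1)) := subset_tsupport _ h
  have := (hφ.support_pos (n + 1) (by omega) hx).1
  simpa using this

lemma continuous (hφ : IsDyadicDecomposition φ) (n : ℕ) : Continuous (φ n) := (hφ.smooth n).continuous

lemma integrable (hφ : IsDyadicDecomposition φ) (n : ℕ) : Integrable (φ n) := by
  refine (hφ.continuous n).integrable_of_hasCompactSupport ?_
  refine HasCompactSupport.intro (isCompact_closedBall (0 : ℝ) (2 ^ (n + 1))) fun x hx => ?_
  by_contra h
  exact hx (by simpa using hφ.abs_le_of_ne_zero h)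

lemma exists_norm_le (hφ : IsDyadicDecomposition φ) : ∃ c : ℝ, ∀ n x, ‖φ n x‖ ≤ c := by
  obtain ⟨c, hc⟩ := hφ.deriv_bound 0
  exact ⟨c, fun n x => by simpa using hc n x⟩

lemma integrable_symbol (hφ : IsDyadicDecomposition φ) {d : ℕ} {f : (Fin d → ℝ) → ℂ}
    (hf : Integrable f) (l : Fin d → ℕ) :
    Integrable fun ξ => (∏ i, φ (l i) (ξ i)) * fourier f ξ := by
  obtain ⟨C, hC⟩ := exists_norm_fourier_le f
  exact (Integrable.fintype_prod fun i => hφ.integrable (l i)).mul_bdd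
    (continuous_fourier hf).aestronglyMeasurable (ae_of_all _ hC)

lemma continuous_block (hφ : IsDyadicDecomposition φ) {d : ℕ} {f : (Fin d → ℝ) → ℂ}
    (hf : Integrable f) (l : Fin d → ℕ) : Continuous (block φ f l) :=
  continuous_fourierInv (hφ.integrable_symbol hf l)

/-- Building blocks are band-limited, hence reproduced by a tensor product of dilated kernels. -/
lemma block_eq_integral (hφ : IsDyadicDecomposition φ) {Ψ : ℝ → ℂ} (hΨ : Integrable Ψ)
    (h : ∀ ξ : ℝ, |ξ| ≤ 2 →
      ∫ z : ℝ, Ψ z * Complex.exp (-(Complex.I * ((ξ * z : ℝ) : ℂ))) = 1)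
    {d : ℕ} {f : (Fin d → ℝ) → ℂ} (hf : Integrable f) (l : Fin d → ℕ) (x : Fin d → ℝ) :
    block φ f l x = ∫ y, block φ f l y * ∏ i, dilate Ψ (l i) ((x - y) i) := by
  refine fourierInv_eq_integral_mul (k := fun z => ∏ i, dilate Ψ (l i) (z i))
    (hφ.integrable_symbol hf l) (Integrable.fintype_prod fun i => integrable_dilate hΨ (l i)) ?_ x
  intro ξ hξ
  have hξ' : ∀ i, |ξ i| ≤ 2 ^ (l i + 1) := fun i =>
    hφ.abs_le_of_ne_zero (Finset.prod_ne_zero_iff.1 (left_ne_zero_of_mul hξ) i (Finset.mem_univ i))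
  have e : ∀ z : Fin d → ℝ, (∏ i, dilate Ψ (l i) (z i)) *
      Complex.exp (-(Complex.I * ((∑ i, ξ i * z i : ℝ) : ℂ))) =
      ∏ i, (dilate Ψ (l i) (z i) * Complex.exp (-(Complex.I * ((ξ i * z i : ℝ) : ℂ)))) := by
    intro z
    rw [Finset.prod_mul_distrib, ← Complex.exp_sum]
    congr 2
    push_cast
    rw [Finset.mul_sum, Finset.sum_neg_distrib]
  simp only [e]
  rw [integral_fintype_prod_volume_eq_prod (fun i (t : ℝ) => dilate Ψ (l i) t *
    Complex.exp (-(Complex.I * ((ξ i * t : ℝ) : ℂ))))]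
  exact Finset.prod_eq_one fun i _ => integral_dilate_mul_cexp h _ _ (hξ' i)

lemma mixedDiff_block_eq_integral (hφ : IsDyadicDecomposition φ) {Ψ : ℝ → ℂ} (hΨ : Integrable Ψ)
    (h : ∀ ξ : ℝ, |ξ| ≤ 2 →
      ∫ z : ℝ, Ψ z * Complex.exp (-(Complex.I * ((ξ * z : ℝ) : ℂ))) = 1)
    {d : ℕ} {f : (Fin d → ℝ) → ℂ} (hf : Integrable f) (l : Fin d → ℕ) (j : Level d)
    (x : Fin d → ℝ) :
    mixedDiff (activeDirs j) (fun i => (2 : ℝ) ^ (-((j i : ℤ) + 1))) (block φ f l) x =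
      ∫ y, block φ f l y * ∏ i, levelKernel Ψ (j i) (l i) (x i - y i) := by
  obtain ⟨C, hC⟩ := exists_norm_fourierInv_le (fun ξ => (∏ i, φ (l i) (ξ i)) * fourier f ξ)
  have hk : Integrable fun z : Fin d → ℝ => ∏ i, dilate Ψ (l i) (z i) :=
    Integrable.fintype_prod fun i => integrable_dilate hΨ (l i)
  rw [mixedDiff_integral (k := fun z => ∏ i, dilate Ψ (l i) (z i)) _ _
    (hφ.block_eq_integral hΨ h hf l), mixedDiff_prod]
  · have hmem : ∀ i, i ∈ activeDirs j ↔ (j i : ℤ) ≠ -1 := fun i => by simp [activeDirs]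
    simp only [levelKernel, hmem, Pi.sub_apply]
  · intro x
    exact (hk.comp_sub_left x).bdd_mul (hφ.continuous_block hf l).aestronglyMeasurable
      (ae_of_all _ hC)

/-- The sampled mixed differences of a building block are controlled by its `L_p` norm. -/
lemma exists_tsum_mixedDiff_block_le (hφ : IsDyadicDecomposition φ) (d : ℕ) {p : ℝ≥0∞}
    (hp1 : 1 ≤ p) (hp : p ≠ ∞) :
    ∃ C : ℝ≥0, 0 < C ∧ ∀ (f : (Fin d → ℝ) → ℂ), Integrable f → ∀ (l : Fin d → ℕ) (j : Level d)
      (x₀ : Fin d → ℝ),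
      (∑' k : Fin d → ℤ, ‖mixedDiff (activeDirs j) (fun i => (2 : ℝ) ^ (-((j i : ℤ) + 1)))
        (block φ f l) (gridPoint j k + x₀)‖ₑ ^ p.toReal) ^ (1 / p.toReal) ≤
      C * ((2 : ℝ≥0∞) ^ ((∑ i, (l i : ℝ)) * (1 / p.toReal)) * eLpNorm (block φ f l) p volume) := by
  obtain ⟨Ψ, hΨ⟩ := exists_schwartz_fourier_eq_one
  have hI : Integrable Ψ := Ψ.integrable
  obtain ⟨C, hC1, hC⟩ := exists_levelKernel_bound (Ψ := Ψ) (Ψ' := SchwartzMap.derivCLM ℝ ℂ Ψ) hI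
    (SchwartzMap.integrable _) (fun x => by
      rw [SchwartzMap.derivCLM_apply]
      exact Ψ.differentiableAt.hasDerivAt)
    (SchwartzMap.continuous _)
  have hp0 : p ≠ 0 := (zero_lt_one.trans_le hp1).ne'
  have hq1 : 1 ≤ p.toReal := by
    rw [← ENNReal.toReal_one]
    exact ENNReal.toReal_mono hp hp1
  set q := p.toReal
  have hq0 : 0 < q := by linarith
  have hC0 : (C : ℝ≥0∞) ≠ 0 := by
    simpa using (zero_lt_one.trans_le hC1).ne'
  have hCd0 : (C : ℝ≥0∞) ^ d ≠ 0 := pow_ne_zero _ hC0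
  have hCdt : (C : ℝ≥0∞) ^ d ≠ ∞ := ENNReal.pow_ne_top ENNReal.coe_ne_top
  -- The free shift `x₀` is absorbed into the integration variable; it later allows pointwise bounds
  -- at arbitrary points.
  refine ⟨C ^ d, pow_pos (zero_lt_one.trans_le hC1) d, fun f hf l j x₀ => ?_⟩
  have hm : ∀ k : Fin d → ℤ, AEMeasurable (fun y : Fin d → ℝ =>
      ∏ i, ‖levelKernel Ψ (j i) (l i) ((gridPoint j k + x₀) i - y i)‖ₑ) := by
    intro k
    have h1 : Integrable fun y : Fin d → ℝ =>
        ∏ i, levelKernel Ψ (j i) (l i) ((gridPoint j k + x₀) i - y i) :=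
      Integrable.fintype_prod fun i => (integrable_levelKernel hI (j i) (l i)).comp_sub_left _
    have h2 := h1.aestronglyMeasurable.enorm
    refine h2.congr (ae_of_all _ fun y => ?_)
    simp only [enorm_eq_nnnorm, nnnorm_prod, ENNReal.ofNNReal_finsetProd]
  have hschur := tsum_lintegral_mul_rpow_le (μ := volume) (A := (C : ℝ≥0∞) ^ d)
    (B := (C : ℝ≥0∞) ^ d * (2 : ℝ≥0∞) ^ (∑ i, (l i : ℝ))) hm
    (hφ.continuous_block hf l).enorm.measurable.aemeasurable hq1 ?_ ?_
  · calc _ ≤ ((C : ℝ≥0∞) ^ d * (2 : ℝ≥0∞) ^ (∑ i, (l i : ℝ)) * ((C : ℝ≥0∞) ^ d) ^ (q - 1) *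
          ∫⁻ y, ‖block φ f l y‖ₑ ^ q) ^ (1 / q) := by
          refine ENNReal.rpow_le_rpow (le_trans ?_ (hschur.trans (le_of_eq (by ring)))) (by positivity)
          refine ENNReal.tsum_le_tsum fun k => ENNReal.rpow_le_rpow ?_ hq0.le
          rw [hφ.mixedDiff_block_eq_integral hI hΨ hf]
          refine (enorm_integral_le_lintegral_enorm _).trans (le_of_eq ?_)
          congr 1
          funext y
          rw [enorm_mul, mul_comm]
          congr 1
          simp only [enorm_eq_nnnorm, nnnorm_prod, ENNReal.ofNNReal_finsetProd]
      -- Schur gives A^{q-1} B with A = C^d and B = C^d 2^{|ℓ|_1}, that is C^{dq} 2^{|ℓ|_1}, whose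
      -- q-th root is the claimed factor.
      _ = (((C : ℝ≥0∞) ^ d) ^ q * ((2 : ℝ≥0∞) ^ (∑ i, (l i : ℝ)) *
          ∫⁻ y, ‖block φ f l y‖ₑ ^ q)) ^ (1 / q) := by
          congr 1
          have : ((C : ℝ≥0∞) ^ d) ^ q = (C : ℝ≥0∞) ^ d * ((C : ℝ≥0∞) ^ d) ^ (q - 1) := by
            conv_rhs => enter [1]; rw [← ENNReal.rpow_one ((C : ℝ≥0∞) ^ d)]
            rw [← ENNReal.rpow_add _ _ hCd0 hCdt]
            congr 1
            ring
          rw [this]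
          ring
      _ = _ := by
          rw [ENNReal.mul_rpow_of_nonneg _ _ (by positivity),
            ENNReal.mul_rpow_of_nonneg _ _ (by positivity), ← ENNReal.rpow_mul, ← ENNReal.rpow_mul,
            mul_one_div_cancel hq0.ne', ENNReal.rpow_one,
            eLpNorm_eq_lintegral_rpow_enorm_toReal hp0 hp]
          push_cast
          rfl
  · intro k
    rw [lintegral_prod_enorm (u := fun i t => levelKernel Ψ (j i) (l i) ((gridPoint j k + x₀) i - t))
      fun i => (integrable_levelKernel hI (j i) (l i)).comp_sub_left _]
    calc _ ≤ ∏ _i : Fin d, (C : ℝ≥0∞) :=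
          Finset.prod_le_prod' fun i _ => (hC (j i) (l i) (j i).2).1 _
      _ = _ := by simp
  · intro y
    refine (tsum_pi_prod_le (fun i (m : ℤ) => ‖levelKernel Ψ (j i) (l i)
      ((2 : ℝ) ^ (-(max (j i : ℤ) 0)) * m + x₀ i - y i)‖ₑ)).trans ?_
    calc _ ≤ ∏ i : Fin d, ((C : ℝ≥0∞) * 2 ^ (l i)) := by
          refine Finset.prod_le_prod' fun i _ => ?_
          have := (hC (j i) (l i) (j i).2).2 (y i - x₀ i)
          simpa only [sub_sub_eq_add_sub] using this
      _ = _ := by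
          rw [Finset.prod_mul_distrib, Finset.prod_const, Finset.card_univ, Fintype.card_fin,
            Finset.prod_pow_eq_pow_sum, ← Nat.cast_sum, ENNReal.rpow_natCast]

end IsDyadicDecomposition

/-! ### Summation of the pieces and reconstruction of f. -/

/-- Minkowski's inequality for infinite sums. -/
lemma tsum_tsum_rpow_le {ι κ : Type*} (a : ι → κ → ℝ≥0∞) {q : ℝ} (hq : 1 ≤ q) :
    (∑' k, (∑' l, a l k) ^ q) ^ (1 / q) ≤ ∑' l, (∑' k, a l k ^ q) ^ (1 / q) := by
  classical
  have hq0 : 0 < q := by linarith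
  have hfin : ∀ (K : Finset κ) (s : Finset ι), (∑ k ∈ K, (∑ l ∈ s, a l k) ^ q) ^ (1 / q) ≤
      ∑ l ∈ s, (∑ k ∈ K, a l k ^ q) ^ (1 / q) := by
    intro K s
    induction s using Finset.induction_on with
    | empty => simp [hq0]
    | insert l s hl ih =>
      simp only [Finset.sum_insert hl]
      exact (ENNReal.Lp_add_le K (a l) (fun k => ∑ l ∈ s, a l k) hq).trans (by gcongr)
  have hcont : Continuous fun t : ℝ≥0∞ => t ^ (1 / q) := ENNReal.continuous_rpow_const
  have hK : ∀ K : Finset κ, (∑ k ∈ K, (∑' l, a l k) ^ q) ^ (1 / q) ≤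
      ∑' l, (∑' k, a l k ^ q) ^ (1 / q) := by
    intro K
    have ht : Tendsto (fun s : Finset ι => (∑ k ∈ K, (∑ l ∈ s, a l k) ^ q) ^ (1 / q)) atTop
        (nhds ((∑ k ∈ K, (∑' l, a l k) ^ q) ^ (1 / q))) := by
      refine (hcont.tendsto _).comp (tendsto_finsetSum _ fun k _ => ?_)
      exact (ENNReal.continuous_rpow_const.tendsto _).comp (ENNReal.summable (f := fun l => a l k)).hasSum
    refine le_of_tendsto' ht fun s => (hfin K s).trans ?_
    refine (ENNReal.sum_le_tsum s).trans (ENNReal.tsum_le_tsum fun l => ?_)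
    gcongr
    exact ENNReal.sum_le_tsum K
  have ht : Tendsto (fun K : Finset κ => (∑ k ∈ K, (∑' l, a l k) ^ q) ^ (1 / q)) atTop
      (nhds ((∑' k, (∑' l, a l k) ^ q) ^ (1 / q))) :=
    (hcont.tendsto _).comp (ENNReal.summable (f := fun k => (∑' l, a l k) ^ q)).hasSum
  exact le_of_tendsto' ht hK

lemma tendsto_piFinset_range (d : ℕ) :
    Tendsto (fun N : ℕ => Fintype.piFinset fun _ : Fin d => Finset.range N) atTop atTop := by
  refine tendsto_atTop_finset_of_monotone ?_ ?_
  · intro M N h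
    exact Fintype.piFinset_subset _ _ fun _ => Finset.range_mono h
  · intro l
    refine ⟨(∑ i, l i) + 1, Fintype.mem_piFinset.2 fun i => Finset.mem_range.2 ?_⟩
    exact Nat.lt_succ_of_le (Finset.single_le_sum (fun _ _ => Nat.zero_le _) (Finset.mem_univ i))

namespace IsDyadicDecomposition

variable {φ : ℕ → ℝ → ℂ}

/-- At most three consecutive φ_n are nonzero at a given point. The bound gives the majorant for
dominated convergence on the Fourier side. -/
lemma exists_norm_sum_range_le (hφ : IsDyadicDecomposition φ) :
    ∃ c : ℝ, ∀ N x, ‖∑ n ∈ Finset.range N, φ n x‖ ≤ c := by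
  classical
  obtain ⟨c, hc⟩ := hφ.exists_norm_le
  have hc0 : 0 ≤ c := (norm_nonneg _).trans (hc 0 0)
  refine ⟨3 * c, fun N x => ?_⟩
  by_cases hx : ∃ n, φ n x ≠ 0
  · set m := Nat.find hx
    have hm : φ m x ≠ 0 := Nat.find_spec hx
    -- With m the first nonzero index, 2^{n-1} ≤ |x| ≤ 2^{m+1} forces n ≤ m + 2.
    have hsub : (Finset.range N).filter (fun n => φ n x ≠ 0) ⊆ Finset.Icc m (m + 2) := by
      intro n hn
      have hn' := (Finset.mem_filter.1 hn).2
      refine Finset.mem_Icc.2 ⟨Nat.find_min' hx hn', ?_⟩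
      rcases Nat.eq_zero_or_pos n with rfl | hpos
      · omega
      obtain ⟨n, rfl⟩ := Nat.exists_eq_add_of_lt hpos
      rw [zero_add] at hn' ⊢
      have h1 := (hφ.le_abs_of_ne_zero hn').trans (hφ.abs_le_of_ne_zero hm)
      have := (pow_le_pow_iff_right₀ (one_lt_two : (1 : ℝ) < 2)).1 h1
      omega
    rw [← Finset.sum_filter_ne_zero]
    refine (norm_sum_le _ _).trans ((Finset.sum_le_card_nsmul _ _ c fun n _ => hc n x).trans ?_)
    rw [nsmul_eq_mul]
    gcongr
    have := Finset.card_le_card hsub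
    rw [Nat.card_Icc] at this
    exact_mod_cast this.trans (by omega)
  · push Not at hx
    rw [Finset.sum_eq_zero fun n _ => hx n, norm_zero]
    positivity

lemma sum_block_eq (hφ : IsDyadicDecomposition φ) {d : ℕ} {f : (Fin d → ℝ) → ℂ}
    (hf : Integrable f) (N : ℕ) (x : Fin d → ℝ) :
    ∑ l ∈ Fintype.piFinset (fun _ : Fin d => Finset.range N), block φ f l x =
      fourierInv (fun ξ => (∏ i, ∑ n ∈ Finset.range N, φ n (ξ i)) * fourier f ξ) x := by
  unfold block
  simp only [fourierInv_eq_fourier_neg]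
  unfold fourier
  rw [← Finset.mul_sum, ← integral_finsetSum]
  · congr 2
    funext ξ
    beta_reduce
    rw [Finset.prod_univ_sum, Finset.sum_mul, Finset.sum_mul]
  · exact fun l _ => integrable_mul_cexp (hφ.integrable_symbol hf l) (-x)

/-- The Fourier transform of f need not be integrable, so inversion is done weakly: the
multiplication formula puts an inverse transform on η, whose integrability supplies the majorant. -/
lemma tendsto_integral_sum_block_mul (hφ : IsDyadicDecomposition φ) {d : ℕ} {f : (Fin d → ℝ) → ℂ}
    (hf : Integrable f) {η : (Fin d → ℝ) → ℂ} (h1 : ContDiff ℝ ((⊤ : ℕ∞) : WithTop ℕ∞) η)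
    (h2 : HasCompactSupport η) :
    Tendsto (fun N : ℕ => ∫ x, (∑ l ∈ Fintype.piFinset (fun _ : Fin d => Finset.range N),
      block φ f l x) * η x) atTop (nhds (∫ x, f x * η x)) := by
  have hη : Integrable η := h1.continuous.integrable_of_hasCompactSupport h2
  have hηi := integrable_fourierInv h1 h2
  obtain ⟨c, hc⟩ := hφ.exists_norm_sum_range_le
  obtain ⟨C, hC⟩ := exists_norm_fourier_le f
  have hG : ∀ N, Integrable fun ξ : Fin d → ℝ =>
      (∏ i, ∑ n ∈ Finset.range N, φ n (ξ i)) * fourier f ξ := fun N =>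
    (Integrable.fintype_prod (f := fun _ t => ∑ n ∈ Finset.range N, φ n t)
      fun _ => integrable_finsetSum _ fun n _ => hφ.integrable n).mul_bdd
      (continuous_fourier hf).aestronglyMeasurable (ae_of_all _ hC)
  have e1 : ∀ N, ∫ x, (∑ l ∈ Fintype.piFinset (fun _ : Fin d => Finset.range N),
      block φ f l x) * η x = ∫ ξ, (∏ i, ∑ n ∈ Finset.range N, φ n (ξ i)) * fourier f ξ *
        fourierInv η ξ := by
    intro N
    simp only [hφ.sum_block_eq hf]
    exact integral_fourierInv_mul (hG N) hη
  have e2 : ∫ x, f x * η x = ∫ ξ, fourier f ξ * fourierInv η ξ := by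
    rw [integral_fourier_mul hf hηi]
    simp only [fourier_fourierInv h1 h2]
  simp only [e1, e2]
  refine tendsto_integral_of_dominated_convergence
    (fun ξ => c ^ d * C * ‖fourierInv η ξ‖) ?_ (hηi.norm.const_mul _) ?_ ?_
  · exact fun N => (hG N).aestronglyMeasurable.mul hηi.aestronglyMeasurable
  · refine fun N => ae_of_all _ fun ξ => ?_
    rw [norm_mul, norm_mul, norm_prod]
    have hc0 : 0 ≤ c := (norm_nonneg _).trans (hc 0 0)
    have : ∏ i, ‖∑ n ∈ Finset.range N, φ n (ξ i)‖ ≤ c ^ d := by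
      calc _ ≤ ∏ _i : Fin d, c := Finset.prod_le_prod (fun _ _ => norm_nonneg _) fun i _ => hc N (ξ i)
        _ = _ := by simp
    gcongr
    exact hC ξ
  · refine ae_of_all _ fun ξ => ?_
    have h : Tendsto (fun N => ∏ i, ∑ n ∈ Finset.range N, φ n (ξ i)) atTop
        (nhds (∏ _i : Fin d, 1)) :=
      tendsto_finsetProd _ fun i _ => (hφ.sum_eq_one (ξ i)).tendsto_sum_nat
    simpa using (h.mul_const (fourier f ξ)).mul_const (fourierInv η ξ)

/-- A uniformly convergent Littlewood–Paley series represents `f`. -/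
lemma tsum_block_ae_eq (hφ : IsDyadicDecomposition φ) {d : ℕ} {f : (Fin d → ℝ) → ℂ}
    (hf : Integrable f) {M : (Fin d → ℕ) → ℝ} (hM : Summable M)
    (hfM : ∀ l x, ‖block φ f l x‖ ≤ M l) :
    Continuous (fun x => ∑' l, block φ f l x) ∧ (fun x => ∑' l, block φ f l x) =ᵐ[volume] f := by
  have hg : Continuous (fun x => ∑' l, block φ f l x) :=
    continuous_tsum (hφ.continuous_block hf) hM hfM
  have hM0 : ∀ l, 0 ≤ M l := fun l => (norm_nonneg _).trans (hfM l 0)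
  refine ⟨hg, ae_eq_of_integral_contDiff_smul_eq hg.locallyIntegrable hf.locallyIntegrable ?_⟩
  intro η₀ h1 h2
  let η : (Fin d → ℝ) → ℂ := fun x => (η₀ x : ℂ)
  have hη1 : ContDiff ℝ ((⊤ : ℕ∞) : WithTop ℕ∞) η := Complex.ofRealCLM.contDiff.comp h1
  have hη2 : HasCompactSupport η := h2.comp_left (g := fun t : ℝ => (t : ℂ)) Complex.ofReal_zero
  have hη : Integrable η := hη1.continuous.integrable_of_hasCompactSupport hη2
  simp only [Complex.real_smul]
  change ∫ x, η x * _ = ∫ x, η x * _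
  simp only [mul_comm (η _)]
  refine tendsto_nhds_unique ?_ (hφ.tendsto_integral_sum_block_mul hf hη1 hη2)
  refine tendsto_integral_of_dominated_convergence (fun x => (∑' l, M l) * ‖η x‖) ?_
    (hη.norm.const_mul _) ?_ ?_
  · exact fun N => ((continuous_finsetSum _ fun l _ => hφ.continuous_block hf l).mul
      hη1.continuous).aestronglyMeasurable
  · refine fun N => ae_of_all _ fun x => ?_
    rw [norm_mul]
    gcongr
    exact (norm_sum_le_of_le _ fun l _ => hfM l x).trans (hM.sum_le_tsum _ fun l _ => hM0 l)
  · refine ae_of_all _ fun x => ?_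
    have hs : Summable fun l => block φ f l x := Summable.of_norm_bounded hM fun l => hfM l x
    exact ((hs.hasSum.comp (tendsto_piFinset_range d))).mul_const (η x)

end IsDyadicDecomposition

end MixedBesov

/-! ### The coefficient estimate. -/

theorem proposition5p3 (d : ℕ) (φ : ℕ → ℝ → ℂ) (hφ : MixedBesov.IsDyadicDecomposition φ)
    (p : ℝ≥0∞) (hp1 : 1 ≤ p) (hp : p ≠ ∞) :
    ∃ c : ℝ≥0, 0 < c ∧ ∀ f : (Fin d → ℝ) → ℂ,
      MixedBesov.MemBesov φ (1 / p.toReal) p 1 f →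
        (∃ g : (Fin d → ℝ) → ℂ, Continuous g ∧ g =ᵐ[volume] f) ∧
        ∀ g : (Fin d → ℝ) → ℂ, Continuous g → g =ᵐ[volume] f →
          MixedBesov.seqNorm (1 / p.toReal) p ∞ (MixedBesov.faberCoeff g) ≤
            (c : ℝ≥0∞) * MixedBesov.besovNorm φ (1 / p.toReal) p 1 f := by
  open MixedBesov in
  obtain ⟨C, hC0, hC⟩ := hφ.exists_tsum_mixedDiff_block_le d hp1 hp
  refine ⟨C, hC0, fun f ⟨hf, hfin⟩ => ?_⟩
  have hq1 : 1 ≤ p.toReal := by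
    rw [← ENNReal.toReal_one]
    exact ENNReal.toReal_mono hp hp1
  have hq0 : 0 < p.toReal := by linarith
  have hnorm : besovNorm φ (1 / p.toReal) p 1 f = ∑' l : Fin d → ℕ,
      (2 : ℝ≥0∞) ^ ((∑ i, (l i : ℝ)) * (1 / p.toReal)) * eLpNorm (block φ f l) p volume := by
    simp [besovNorm, lqNorm]
  rw [hnorm] at hfin ⊢
  set a : (Fin d → ℕ) → ℝ≥0∞ := fun l =>
    (2 : ℝ≥0∞) ^ ((∑ i, (l i : ℝ)) * (1 / p.toReal)) * eLpNorm (block φ f l) p volume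
  -- Nikolskii's inequality: at level -1 in every direction, shift by x and keep only the term k = 0
  -- of the ℓ_p sum.
  have hsup : ∀ l x, ‖block φ f l x‖ₑ ≤ C * a l := by
    intro l x
    refine le_trans ?_ (hC f hf l (fun _ => ⟨-1, le_rfl⟩) x)
    have h0 := ENNReal.le_tsum (f := fun k : Fin d → ℤ =>
      ‖mixedDiff (activeDirs (d := d) fun _ => ⟨-1, le_rfl⟩) (fun _ => (2 : ℝ) ^ (-((-1 : ℤ) + 1)))
        (block φ f l) (gridPoint (fun _ => ⟨-1, le_rfl⟩) k + x)‖ₑ ^ p.toReal) 0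
    refine le_trans (le_of_eq ?_) (ENNReal.rpow_le_rpow h0 (by positivity))
    have e1 : activeDirs (d := d) (fun _ => ⟨-1, le_rfl⟩) = ∅ := by simp [activeDirs]
    have e2 : gridPoint (d := d) (fun _ => ⟨-1, le_rfl⟩) 0 = 0 := by
      funext i
      simp [gridPoint]
    have e3 : ∀ (h : Fin d → ℝ) (u : (Fin d → ℝ) → ℂ), mixedDiff ∅ h u = u := by
      intro h u
      simp [mixedDiff]
    rw [e1, e2, e3, zero_add, ← ENNReal.rpow_mul, mul_one_div_cancel hq0.ne', ENNReal.rpow_one]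
  have hCa : ∑' l, (C : ℝ≥0∞) * a l ≠ ∞ := by
    rw [ENNReal.tsum_mul_left]
    exact ENNReal.mul_ne_top ENNReal.coe_ne_top hfin.ne
  have hM : Summable fun l => ((C : ℝ≥0∞) * a l).toReal := ENNReal.summable_toReal hCa
  have hfM : ∀ l x, ‖block φ f l x‖ ≤ ((C : ℝ≥0∞) * a l).toReal := by
    intro l x
    rw [← toReal_enorm]
    exact ENNReal.toReal_mono (ENNReal.ne_top_of_tsum_ne_top hCa l) (hsup l x)
  obtain ⟨hgc, hgf⟩ := hφ.tsum_block_ae_eq hf hM hfM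
  refine ⟨⟨_, hgc, hgf⟩, fun g hg hgf' => ?_⟩
  -- Continuous functions equal almost everywhere coincide, so point values of g may be computed
  -- from the series.
  have hgg : g = fun x => ∑' l, block φ f l x :=
    (Continuous.ae_eq_iff_eq volume hg hgc).1 (hgf'.trans hgf.symm)
  have hsum : ∀ x, HasSum (fun l => block φ f l x) (g x) := by
    intro x
    rw [hgg]
    exact (Summable.of_norm_bounded hM fun l => hfM l x).hasSum
  unfold seqNorm
  rw [lqNorm, if_pos rfl]
  refine iSup_le fun j => ?_
  -- The smoothness 1/p makes the weight of the sequence norm trivial.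
  rw [sub_self, mul_zero, ENNReal.rpow_zero, one_mul, lqNorm, if_neg hp]
  set D := fun u : (Fin d → ℝ) → ℂ =>
    mixedDiff (activeDirs j) (fun i => (2 : ℝ) ^ (-((j i : ℤ) + 1))) u
  have hD : ∀ x, ‖D g x‖ₑ ≤ ∑' l, ‖D (block φ f l) x‖ₑ := by
    intro x
    obtain ⟨ι, _, c, v, hcv⟩ :=
      exists_mixedDiff_eq_sum (activeDirs j) (fun i => (2 : ℝ) ^ (-((j i : ℤ) + 1)))
    have hs : HasSum (fun l => D (block φ f l) x) (D g x) := by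
      simp only [D, hcv]
      exact hasSum_sum fun b _ => (hsum _).mul_left (c b)
    rw [← hs.tsum_eq]
    exact enorm_tsum_le_tsum_enorm
  have hcoef : ∀ k, ‖faberCoeff g j k‖ₑ ≤ ∑' l, ‖D (block φ f l) (gridPoint j k)‖ₑ := by
    intro k
    refine le_trans ?_ (hD _)
    rw [faberCoeff, enorm_mul]
    -- The normalisation (-2)^{-|e(j)|} has modulus at most one and is discarded.
    refine mul_le_of_le_one_left' ?_
    rw [enorm_eq_nnnorm, ← ENNReal.coe_one, ENNReal.coe_le_coe, nnnorm_inv, nnnorm_pow, nnnorm_neg]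
    refine inv_le_one_of_one_le₀ (one_le_pow₀ ?_)
    simp
  calc _ ≤ (∑' k, (∑' l, ‖D (block φ f l) (gridPoint j k)‖ₑ) ^ p.toReal) ^ (1 / p.toReal) := by
        gcongr with k
        exact hcoef k
    _ ≤ ∑' l, (∑' k, ‖D (block φ f l) (gridPoint j k)‖ₑ ^ p.toReal) ^ (1 / p.toReal) :=
        tsum_tsum_rpow_le _ hq1
    _ ≤ ∑' l, C * a l := by
        refine ENNReal.tsum_le_tsum fun l => ?_
        simpa only [add_zero] using hC f hf l j 0
    _ = _ := ENNReal.tsum_mul_left
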